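/- All graphs are finite and simple. A weighted graph is a graph $G$ together with a weighting $w:E(G)\to(0,\infty]$. The length of a path is the sum of the weights of its edges, and $\mathrm{dist}_G(u,v)$ is the length of a shortest path from $u$ to $v$ in $G$, or $\infty$ if there is none. The radius of $G$ is the smallest $r$ for which some vertex $u$ satisfies $\mathrm{dist}_G(u,v)\le r$ for every vertex $v$. The weak diameter in $G$ of $S\subseteq V(G)$ is the maximum of $\mathrm{dist}_G(u,v)$ over $u,v\in S$. For a real $r>0$, $G^r$ is the graph on $V(G)$ in which distinct $u,v$ are adjacent if $\mathrm{dist}_G(u,v)\le r$. For a colouring $c$ of $V(G)$, a monochromatic $r$-component is a maximal nonempty connected subgraph of $G^r$ all of whose vertices have one given colour. An $(m,r,d)$-colouring of $G$ is a colouring of $V(G)$ with $m$ colours such that the vertex set of each monochromatic $r$-component has weak diameter at most $d$ in $G$. A function $f:(0,\infty)\to(0,\infty)$ is a dilation if there is a real $c>0$ with $f(r)\le cr$ for all $r>0$. For a real $\ell\ge 0$ and an integer $n\geq 0$, $f$ is an $\ell$-almost $n$-dimensional control function for $G$ if $G$ admits an $(n+1,r,f(r))$-colouring for every real $r>0$ with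 $r\ge\ell$. A partition $\mathcal P$ of $G$ is a partition of $V(G)$ into nonempty parts, each inducing a connected subgraph of $G$. Its quotient $G/\mathcal P$ is the graph with vertex set $\mathcal P$ in which two distinct parts are adjacent if some edge of $G$ joins them. The partition is $\ell$-shallow if for each part $P$ the weighted induced subgraph $G[P]$ has radius at most $\ell$, and it is a $(k,\ell)$-partition if moreover $G/\mathcal P$ has treewidth at most $k$. Theorem. For every integer $k\ge 0$ there exists a dilation $f_k$ such that for every real number $\ell\ge 0$, $f_k$ is an $\ell$-almost $1$-dimensional control function for every weighted graph that admits a $(k,\ell)$-partition. -/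

import Mathlib

open scoped ENNReal

/-- A weighted graph on the vertex type `V`: a simple graph with a weighting
`E(G) → ℝ⁺ ∪ {∞}` of its edges. -/
structure WeightedGraph (V : Type*) where
  graph : SimpleGraph V
  weight : graph.edgeSet → ℝ≥0∞
  weight_pos : ∀ e, 0 < weight e

namespace WeightedGraph

variable {V : Type*}

/-- The length of a walk: the sum of the weights of the edges between consecutive vertices. -/
def walkLength (G : WeightedGraph V) {u v : V} (p : G.graph.Walk u v) : ℝ≥0∞ :=
  (p.darts.map fun d => G.weight ⟨d.edge, d.edge_mem⟩).sum

/-- The distance between two vertices: the length of a shortest path, and `∞` if there is no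
path. (In a finite graph the infimum is attained whenever there is a path.) -/
noncomputable def dist (G : WeightedGraph V) (u v : V) : ℝ≥0∞ :=
  ⨅ p : G.graph.Path u v, G.walkLength p.1

theorem walkLength_reverse (G : WeightedGraph V) {u v : V} (p : G.graph.Walk u v) :
    G.walkLength p.reverse = G.walkLength p := by
  simp only [walkLength, SimpleGraph.Walk.darts_reverse, List.map_reverse, List.sum_reverse,
    List.map_map]
  congr 1
  refine List.map_congr_left fun d _ => ?_
  simp only [Function.comp]
  congr 2
  exact SimpleGraph.Dart.edge_symm d

theorem dist_comm (G : WeightedGraph V) (u v : V) : G.dist u v = G.dist v u := by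
  have key : ∀ a b : V, G.dist a b ≤ G.dist b a := fun a b =>
    le_iInf fun p => (iInf_le _ p.reverse).trans (G.walkLength_reverse p.1).le
  exact le_antisymm (key u v) (key v u)

/-- The subgraph induced by `S`, with the inherited weighting. -/
def induce (G : WeightedGraph V) (S : Set V) : WeightedGraph S where
  graph := G.graph.induce S
  weight e := G.weight ((SimpleGraph.Embedding.induce S).toHom.mapEdgeSet e)
  weight_pos _ := G.weight_pos _

/-- The radius: the least `r` such that some vertex is at distance at most `r` from every
vertex. -/
noncomputable def radius (G : WeightedGraph V) : ℝ≥0∞ :=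
  ⨅ u, ⨆ v, G.dist u v

/-- The weak diameter of `S`: the maximum distance, measured in the whole graph `G`,
between vertices of `S`. -/
noncomputable def weakDiam (G : WeightedGraph V) (S : Set V) : ℝ≥0∞ :=
  ⨆ u ∈ S, ⨆ v ∈ S, G.dist u v

/-- The `r`-th power of `G`: distinct vertices are adjacent if they are at distance at most `r`
in `G`. -/
def power (G : WeightedGraph V) (r : ℝ) : SimpleGraph V where
  Adj u v := u ≠ v ∧ G.dist u v ≤ ENNReal.ofReal r
  symm := ⟨fun u v h => ⟨h.1.symm, by rw [G.dist_comm]; exact h.2⟩⟩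
  loopless := ⟨fun _ h => h.1 rfl⟩

/-- `M` is an `i`-monochromatic `r`-component of `G` under `c`: a maximal (nonempty) connected
subgraph of the `r`-th power of `G` all of whose vertices have colour `i`. -/
def IsMonochromaticComponent (G : WeightedGraph V) {C : Type*} (c : V → C) (r : ℝ) (i : C)
    (M : (G.power r).Subgraph) : Prop :=
  Maximal (fun N : (G.power r).Subgraph => N.Connected ∧ ∀ v ∈ N.verts, c v = i) M

/-- `c` is an `(m, r, d)`-colouring of `G`. -/
def IsColouring (G : WeightedGraph V) (m : ℕ) (r d : ℝ) (c : V → Fin m) : Prop :=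
  ∀ (i : Fin m) (M : (G.power r).Subgraph), G.IsMonochromaticComponent c r i M →
    G.weakDiam M.verts ≤ ENNReal.ofReal d

/-- `f` is an `ℓ`-almost `n`-dimensional control function for `G`: for every real `r > 0` with
`r ≥ ℓ`, the weighted graph `G` admits an `(n + 1, r, f r)`-colouring. -/
def IsAlmostControlFunction (G : WeightedGraph V) (ℓ : ℝ) (n : ℕ)
    (f : Set.Ioi (0 : ℝ) → Set.Ioi (0 : ℝ)) : Prop :=
  ∀ r : Set.Ioi (0 : ℝ), ℓ ≤ r → ∃ c : V → Fin (n + 1), G.IsColouring (n + 1) r (f r) c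

/-- A partition of `G`: a partition of the vertex set into nonempty parts, each of which induces
a connected subgraph. -/
structure Partition (G : WeightedGraph V) where
  parts : Set (Set V)
  isPartition : Setoid.IsPartition parts
  connected : ∀ P ∈ parts, (G.graph.induce P).Connected

/-- The quotient `G / π`: its vertices are the parts, and two distinct parts are adjacent if
some edge of `G` joins them. -/
def Partition.quotient {G : WeightedGraph V} (π : G.Partition) : SimpleGraph π.parts where
  Adj P Q := P ≠ Q ∧ ∃ u ∈ P.1, ∃ v ∈ Q.1, G.graph.Adj u v
  symm := ⟨fun _ _ h => ⟨h.1.symm, by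
    obtain ⟨u, hu, v, hv, huv⟩ := h.2
    exact ⟨v, hv, u, hu, huv.symm⟩⟩⟩
  loopless := ⟨fun _ h => h.1 rfl⟩

/-- Each part induces a weighted subgraph of radius at most `ℓ`. -/
def Partition.IsShallow {G : WeightedGraph V} (π : G.Partition) (ℓ : ℝ) : Prop :=
  ∀ P ∈ π.parts, (G.induce P).radius ≤ ENNReal.ofReal ℓ

end WeightedGraph

namespace SimpleGraph

/-- An `H`-decomposition of the graph `G`. -/
structure HDecomposition {V T : Type*} (G : SimpleGraph V) (H : SimpleGraph T) where
  bag : T → Finset V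
  connected : ∀ v : V, (H.induce {x | v ∈ bag x}).Connected
  edge : ∀ u v : V, G.Adj u v → ∃ x, u ∈ bag x ∧ v ∈ bag x

/-- The width of a decomposition, the maximum size of a bag minus one, as an integer (it is `-1`
if all bags are empty). The maximum is over a finite index set. -/
noncomputable def HDecomposition.width {V T : Type*} [Finite T] {G : SimpleGraph V}
    {H : SimpleGraph T} (D : G.HDecomposition H) : ℤ :=
  ((⨆ x, (D.bag x).card : ℕ) : ℤ) - 1

/-- The treewidth of a finite graph: the minimum width of a tree-decomposition. -/
noncomputable def treewidth {V : Type*} [Finite V] (G : SimpleGraph V) : ℤ :=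
  sInf {w : ℤ | ∃ (T : Type) (_ : Finite T) (H : SimpleGraph T) (_ : H.IsTree)
    (D : G.HDecomposition H), D.width = w}

end SimpleGraph

/-- `π` is a `(k, ℓ)`-partition: it is `ℓ`-shallow and its quotient has treewidth at most `k`. -/
def WeightedGraph.Partition.IsKLPartition {V : Type*} [Finite V] {G : WeightedGraph V}
    (π : G.Partition) (k : ℕ) (ℓ : ℝ) : Prop :=
  π.IsShallow ℓ ∧ π.quotient.treewidth ≤ (k : ℤ)

/-- A function `f : ℝ⁺ → ℝ⁺` is a dilation if `f r ≤ c * r` for some constant `c > 0` and all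
`r > 0`. -/
def IsDilation (f : Set.Ioi (0 : ℝ) → Set.Ioi (0 : ℝ)) : Prop :=
  ∃ c : ℝ, 0 < c ∧ ∀ r : Set.Ioi (0 : ℝ), (f r : ℝ) ≤ c * r

/-! ### Chains running through few sets of small diameter -/

namespace SimpleGraph

variable {V : Type*}

/-! Take `r ≥ ℓ` and a tree-decomposition of the quotient, and thicken every bag to the `r`-ball
around its parts. Join vertices of a common thick bag at distance at most `4r`. The ball around a
shallow part becomes a clique, so each bag is covered by `k + 1` cliques, and the new unweighted
graph `Γ` contains `G^r`. It remains to 2-colour such a `Γ` with components of bounded weak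
diameter.

The induction is on the number of cliques, then on the root of the subtree, with root bag `B`
precoloured arbitrarily and its next two layers coloured `true` and `false`. The core consists of
the root and the nodes whose bags meet `N[B]`. Deleting `N[N[B]]` from a core bag deletes a whole
clique, so the rest of the core is coloured with one clique fewer (`inner`). Each subtree hanging
off the core is coloured with its root bag precoloured (`lower`).

A monochromatic walk cannot cross both prescribed layers, so its excursions from the core into a
hanging subtree stay next to that subtree's root bag and are short. Replacing them by single edges
leaves a chain in the core, bounded by induction outside `N[N[B]]`, itself covered by few small sets
(`edist_le_of_glued`). Components missing the core lie in one hanging subtree and keep the same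
bound, so depth costs nothing. -/

/-- The edges of `Q` joining two vertices outside `S`. -/
def avoid (Q : SimpleGraph V) (S : Set V) : SimpleGraph V where
  Adj a b := Q.Adj a b ∧ a ∉ S ∧ b ∉ S
  symm := ⟨fun _ _ h => ⟨h.1.symm, h.2.2, h.2.1⟩⟩
  loopless := ⟨fun _ h => h.1.ne rfl⟩

/-- The edges of `Γ` whose ends have the same colour. -/
def mono (Γ : SimpleGraph V) (c : V → Bool) : SimpleGraph V where
  Adj a b := Γ.Adj a b ∧ c a = c b
  symm := ⟨fun _ _ h => ⟨h.1.symm, h.2.symm⟩⟩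
  loopless := ⟨fun _ h => h.1.ne rfl⟩

/-- The closed neighbourhood of `S`. -/
def nhd (Γ : SimpleGraph V) (S : Set V) : Set V :=
  {v | ∃ u ∈ S, u = v ∨ Γ.Adj u v}

theorem subset_nhd (Γ : SimpleGraph V) (S : Set V) : S ⊆ Γ.nhd S :=
  fun v hv => ⟨v, hv, Or.inl rfl⟩

theorem edist_le_add {Γ : SimpleGraph V} {u v w : V} {m n l : ℕ} (h₁ : Γ.edist u v ≤ m)
    (h₂ : Γ.edist v w ≤ n) (h : m + n ≤ l) : Γ.edist u w ≤ l :=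
  calc Γ.edist u w ≤ Γ.edist u v + Γ.edist v w := Γ.edist_triangle
    _ ≤ m + n := add_le_add h₁ h₂
    _ ≤ l := by exact_mod_cast h

theorem avoid_empty (Q : SimpleGraph V) : Q.avoid ∅ = Q := by
  ext a b; simp [avoid]

theorem avoid_avoid (Q : SimpleGraph V) (S R : Set V) :
    (Q.avoid S).avoid R = Q.avoid (S ∪ R) := by
  ext a b; simp only [avoid, Set.mem_union]; tauto

theorem avoid_anti (Q : SimpleGraph V) {S R : Set V} (h : S ⊆ R) : Q.avoid R ≤ Q.avoid S :=
  fun _ _ hab => ⟨hab.1, fun ha => hab.2.1 (h ha), fun hb => hab.2.2 (h hb)⟩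

theorem Reachable.avoid_or_meets {Q : SimpleGraph V} (S : Set V) {u v : V}
    (h : Q.Reachable u v) :
    (Q.avoid S).Reachable u v ∨
      ∃ w ∈ S, u = w ∨ ∃ z, (Q.avoid S).Reachable u z ∧ Q.Adj z w := by
  rw [reachable_iff_reflTransGen] at h
  induction h with
  | refl => exact Or.inl (Reachable.refl _)
  | @tail b c _ hbc ih =>
    rcases ih with ih | ih
    · by_cases hc : c ∈ S
      · exact Or.inr ⟨c, hc, Or.inr ⟨b, ih, hbc⟩⟩
      by_cases hb : b ∈ S
      · rw [reachable_iff_reflTransGen] at ih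
        rcases Relation.ReflTransGen.cases_tail ih with rfl | ⟨z, -, hz⟩
        · exact Or.inr ⟨b, hb, Or.inl rfl⟩
        · exact absurd hb hz.2.2
      · exact Or.inl (ih.trans (Adj.reachable (show (Q.avoid S).Adj b c from ⟨hbc, hb, hc⟩)))
    · exact Or.inr ih

/-- Cut the chain at its first and last visits to `K`: the outer portions cost `e + q` each, and the
two visits are at distance at most `a`, whatever happens between them. -/
theorem edist_le_of_avoid {Γ Q : SimpleGraph V} {K : Set V} {e q a : ℕ}
    (hK : ∀ u ∈ K, ∀ v ∈ K, Γ.edist u v ≤ a) (hQ : ∀ u v, Q.Adj u v → Γ.edist u v ≤ q)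
    (he : ∀ u v, (Q.avoid K).Reachable u v → Γ.edist u v ≤ e) {u v : V}
    (h : Q.Reachable u v) : Γ.edist u v ≤ (2 * e + 2 * q + a : ℕ) := by
  have key : ∀ u w, (u = w ∨ ∃ z, (Q.avoid K).Reachable u z ∧ Q.Adj z w) →
      Γ.edist u w ≤ (e + q : ℕ) := by
    rintro u w (rfl | ⟨z, hz, hzw⟩)
    · simp
    · exact edist_le_add (he _ _ hz) (hQ _ _ hzw) le_rfl
  rcases h.avoid_or_meets K with h' | ⟨w, hw, h₁⟩
  · exact (he _ _ h').trans (by exact_mod_cast (by omega))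
  rcases h.symm.avoid_or_meets K with h' | ⟨w', hw', h₂⟩
  · exact (he _ _ h'.symm).trans (by exact_mod_cast (by omega))
  refine edist_le_add (edist_le_add (key _ _ h₁) (hK _ hw _ hw') le_rfl)
    (by rw [edist_comm]; exact key _ _ h₂) (by omega)

/-- The bound on the length of a chain meeting at most `n` sets of diameter at most `a`, where
consecutive elements are at distance at most `q`, and where the portions of the chain outside
those sets have diameter at most `e`. -/
def chainBound (e q a : ℕ) : ℕ → ℕ
  | 0 => e
  | n + 1 => 2 * chainBound e q a n + 2 * q + a

theorem le_chainBound (e q a n : ℕ) : e ≤ chainBound e q a n := by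
  induction n with
  | zero => exact le_rfl
  | succ n ih => simp only [chainBound]; omega

/-- The set `S` is covered by at most `k` sets of diameter at most `a`. -/
def Covered (Γ : SimpleGraph V) (k a : ℕ) (S : Set V) : Prop :=
  ∃ 𝒦 : Finset (Set V), 𝒦.card ≤ k ∧ (∀ K ∈ 𝒦, ∀ u ∈ K, ∀ v ∈ K, Γ.edist u v ≤ a) ∧
    S ⊆ ⋃₀ (𝒦 : Set (Set V))

-- Covering sets are removed one at a time. `Q` varies in the induction because each removal
-- replaces it by `Q.avoid K`.
open Classical in
theorem Covered.edist_le_chainBound {Γ : SimpleGraph V} {e q a n : ℕ} {S : Set V}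
    (hS : Γ.Covered n a S) {Q : SimpleGraph V} (hQ : ∀ u v, Q.Adj u v → Γ.edist u v ≤ q)
    (he : ∀ u v, (Q.avoid S).Reachable u v → Γ.edist u v ≤ e) {u v : V}
    (h : Q.Reachable u v) : Γ.edist u v ≤ chainBound e q a n := by
  obtain ⟨𝒦, hcard, hdiam, hcov⟩ := hS
  replace he : ∀ u v, (Q.avoid (⋃₀ (𝒦 : Set (Set V)))).Reachable u v → Γ.edist u v ≤ e :=
    fun u v huv => he u v (huv.mono (Q.avoid_anti hcov))
  clear hcov
  induction n generalizing Q 𝒦 u v with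
  | zero =>
    obtain rfl : 𝒦 = ∅ := Finset.card_eq_zero.mp (by omega)
    exact he _ _ (by simpa [avoid_empty] using h)
  | succ n ih =>
    rcases 𝒦.eq_empty_or_nonempty with rfl | ⟨K, hK⟩
    · refine (he _ _ (by simpa [avoid_empty] using h)).trans ?_
      exact_mod_cast le_chainBound e q a (n + 1)
    refine edist_le_of_avoid (hdiam K hK) hQ (fun u v huv => ?_) h
    refine ih (Q := Q.avoid K) (fun u v h => hQ u v h.1) huv (𝒦.erase K) ?_
      (fun L hL => hdiam L (Finset.mem_of_mem_erase hL)) ?_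
    · rw [Finset.card_erase_of_mem hK]; omega
    · intro u v huv
      refine he u v ?_
      rw [avoid_avoid, ← Set.sUnion_insert, ← Finset.coe_insert, Finset.insert_erase hK] at huv
      exact huv

open Classical in
theorem Covered.nhd {Γ : SimpleGraph V} {k a : ℕ} {S : Set V} (h : Γ.Covered k a S) :
    Γ.Covered k (a + 2) (Γ.nhd S) := by
  obtain ⟨𝒦, hcard, hdiam, hcov⟩ := h
  refine ⟨𝒦.image Γ.nhd, Finset.card_image_le.trans hcard, ?_, ?_⟩
  · simp only [Finset.mem_image, forall_exists_index, and_imp, forall_apply_eq_imp_iff₂]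
    rintro K hK u ⟨u', hu', hu⟩ v ⟨v', hv', hv⟩
    have h₁ : Γ.edist u u' ≤ (1 : ℕ) := by
      rw [Nat.cast_one, edist_le_one_iff_adj_or_eq]
      rcases hu with rfl | hu
      · exact Or.inr rfl
      · exact Or.inl hu.symm
    have h₂ : Γ.edist v' v ≤ (1 : ℕ) := by
      rw [Nat.cast_one, edist_le_one_iff_adj_or_eq]
      exact hv.symm
    exact edist_le_add (edist_le_add h₁ (hdiam K hK _ hu' _ hv') le_rfl) h₂ (by omega)
  · rintro v ⟨u, hu, huv⟩
    obtain ⟨K, hK, huK⟩ := hcov hu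
    exact ⟨Γ.nhd K, by simpa using ⟨K, hK, rfl⟩, u, huK, huv⟩

end SimpleGraph

/-! ### Subtrees in forest orders -/

/-- In a forest order, the elements above a given one form a chain. -/
def IsForestOrder (T : Type*) [PartialOrder T] : Prop :=
  ∀ x y z : T, x ≤ y → x ≤ z → y ≤ z ∨ z ≤ y

section Linked

variable {T : Type*} [PartialOrder T]

/-- In a forest order, `x` and `y` are joined by a path inside `S`. -/
def Linked (S : Set T) (x y : T) : Prop :=
  ∃ t, x ≤ t ∧ y ≤ t ∧ Set.Icc x t ⊆ S ∧ Set.Icc y t ⊆ S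

theorem Linked.symm {S : Set T} {x y : T} : Linked S x y → Linked S y x :=
  fun ⟨t, h₁, h₂, h₃, h₄⟩ => ⟨t, h₂, h₁, h₄, h₃⟩

theorem Linked.mono {S S' : Set T} (h : S ⊆ S') {x y : T} : Linked S x y → Linked S' x y :=
  fun ⟨t, h₁, h₂, h₃, h₄⟩ => ⟨t, h₁, h₂, h₃.trans h, h₄.trans h⟩

/-- The two meeting points both lie above `y`, hence are comparable; the higher one serves for `x`
and `z`. -/
theorem Linked.trans (hT : IsForestOrder T) {S : Set T} {x y z : T} (h₁ : Linked S x y)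
    (h₂ : Linked S y z) : Linked S x z := by
  have aux : ∀ {x t t' : T}, y ≤ t → x ≤ t → t ≤ t' → Set.Icc x t ⊆ S → Set.Icc y t' ⊆ S →
      Set.Icc x t' ⊆ S := by
    intro x t t' hyt hxt htt' hx hy w hw
    rcases hT x w t hw.1 hxt with h | h
    · exact hx ⟨hw.1, h⟩
    · exact hy ⟨hyt.trans h, hw.2⟩
  obtain ⟨t, hxt, hyt, hx, hy⟩ := h₁
  obtain ⟨t', hyt', hzt', hy', hz⟩ := h₂
  rcases hT y t t' hyt hyt' with h | h
  · exact ⟨t', hxt.trans h, hzt', aux hyt hxt h hx hy', hz⟩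
  · exact ⟨t, hxt, hzt'.trans h, hx, aux hyt' hzt' h hz hy⟩

theorem Linked.mem_of_Icc {S : Set T} {x y z : T} (h : Linked S x y) (hxz : x ≤ z)
    (hzy : z ≤ y) : z ∈ S := by
  obtain ⟨t, -, hyt, hx, -⟩ := h
  exact hx ⟨hxz, hzy.trans hyt⟩

/-- Climbing from `x` to a point above `y` must pass every such `z`, since otherwise `z` would be
above `y`. -/
theorem Linked.mem_of_le {S : Set T} (hT : IsForestOrder T) {x y z : T} (h : Linked S x y)
    (hxz : x ≤ z) (hyz : ¬ y ≤ z) : z ∈ S := by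
  obtain ⟨t, hxt, hyt, hx, -⟩ := h
  rcases hT x z t hxz hxt with h | h
  · exact hx ⟨hxz, h⟩
  · exact absurd (hyt.trans h) hyz

end Linked

/-! ### Clique decompositions, the core and its hanging subtrees -/

/-- `bag` is a tree-decomposition of `Γ` indexed by the elements of a forest order below `ρ`, and
every bag is covered by at most `k` cliques. -/
structure CliqueDecomposition {V T : Type*} [PartialOrder T] (Γ : SimpleGraph V)
    (bag : T → Set V) (k : ℕ) (ρ : T) : Prop where
  le_root : ∀ {x v}, v ∈ bag x → x ≤ ρ
  edge : ∀ {u v}, Γ.Adj u v → ∃ x, u ∈ bag x ∧ v ∈ bag x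
  linked : ∀ {v x y}, v ∈ bag x → v ∈ bag y → Linked {z | v ∈ bag z} x y
  cliques : ∀ x, ∃ 𝒦 : Finset (Set V), 𝒦.card ≤ k ∧ (∀ K ∈ 𝒦, Γ.IsClique K) ∧
    bag x ⊆ ⋃₀ (𝒦 : Set (Set V))

namespace CliqueDecomposition

variable {V T : Type*} [PartialOrder T] {Γ : SimpleGraph V} {bag : T → Set V} {k : ℕ} {ρ : T}

theorem covered (D : CliqueDecomposition Γ bag k ρ) (x : T) : Γ.Covered k 1 (bag x) := by
  obtain ⟨𝒦, hcard, hcl, hcov⟩ := D.cliques x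
  refine ⟨𝒦, hcard, fun K hK u hu v hv => ?_, hcov⟩
  rw [Nat.cast_one, SimpleGraph.edist_le_one_iff_adj_or_eq]
  by_cases h : u = v
  · exact Or.inr h
  · exact Or.inl (hcl K hK hu hv h)

/-- The nodes whose bag meets the closed neighbourhood of the root bag, together with the
root. -/
def core (Γ : SimpleGraph V) (bag : T → Set V) (ρ : T) : Set T :=
  {x | x ≤ ρ ∧ (x = ρ ∨ ∃ v ∈ bag x, v ∈ Γ.nhd (bag ρ))}

/-- The vertices in the bags of the core. -/
def coreVerts (Γ : SimpleGraph V) (bag : T → Set V) (ρ : T) : Set V :=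
  {v | ∃ x ∈ core Γ bag ρ, v ∈ bag x}

/-- The maximal nodes outside the core. -/
def IsHanging (Γ : SimpleGraph V) (bag : T → Set V) (ρ y : T) : Prop :=
  y ≤ ρ ∧ y ∉ core Γ bag ρ ∧ ∀ z, y < z → z ≤ ρ → z ∈ core Γ bag ρ

theorem IsHanging.lt {y : T} (h : IsHanging Γ bag ρ y) : y < ρ :=
  lt_of_le_of_ne h.1 fun e => h.2.1 ⟨h.1, Or.inl e⟩

theorem IsHanging.unique (hT : IsForestOrder T) {x y y' : T} (h : IsHanging Γ bag ρ y)
    (h' : IsHanging Γ bag ρ y') (hy : x ≤ y) (hy' : x ≤ y') : y = y' := by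
  by_contra hne
  rcases hT x y y' hy hy' with hle | hle
  · exact h'.2.1 (h.2.2 _ (lt_of_le_of_ne hle hne) h'.1)
  · exact h.2.1 (h'.2.2 _ (lt_of_le_of_ne hle (Ne.symm hne)) h.1)

theorem exists_isHanging [Finite T] {x : T} (hx : x ≤ ρ) (hxc : x ∉ core Γ bag ρ) :
    ∃ y, x ≤ y ∧ IsHanging Γ bag ρ y := by
  obtain ⟨y, hxy, hy⟩ := (Set.toFinite {z | z ≤ ρ ∧ z ∉ core Γ bag ρ}).exists_le_maximal
    (show x ∈ _ from ⟨hx, hxc⟩)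
  refine ⟨y, hxy, hy.prop.1, hy.prop.2, fun z hyz hz => ?_⟩
  by_contra hzc
  exact hyz.not_ge (hy.2 ⟨hz, hzc⟩ hyz.le)

/-- The bags containing `v` or its neighbour `u` in the root bag form a connected set joining `x` to
`ρ`, so it contains every node between them. -/
theorem core_upward (hT : IsForestOrder T) (D : CliqueDecomposition Γ bag k ρ) {x z : T}
    (hx : x ∈ core Γ bag ρ) (hxz : x ≤ z) (hz : z ≤ ρ) : z ∈ core Γ bag ρ := by
  obtain ⟨-, rfl | ⟨v, hv, u, hu, huv⟩⟩ := hx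
  · exact ⟨hz, Or.inl (le_antisymm hz hxz)⟩
  refine ⟨hz, Or.inr ?_⟩
  rcases huv with rfl | huv
  · exact ⟨u, (D.linked hv hu).mem_of_Icc hxz hz, Γ.subset_nhd _ hu⟩
  obtain ⟨x', hux, hvx⟩ := D.edge huv
  by_cases hle : x' ≤ z
  · exact ⟨u, (D.linked hux hu).mem_of_Icc hle hz, Γ.subset_nhd _ hu⟩
  · exact ⟨v, (D.linked hv hvx).mem_of_le hT hxz hle, u, hu, Or.inr huv⟩

theorem le_of_notMem_coreVerts (hT : IsForestOrder T) (D : CliqueDecomposition Γ bag k ρ)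
    {v : V} {x x' y : T} (hv : v ∉ coreVerts Γ bag ρ) (hx : v ∈ bag x) (hxy : x ≤ y)
    (hy : IsHanging Γ bag ρ y) (hx' : v ∈ bag x') : x' ≤ y := by
  obtain ⟨t, hxt, hxt', h, -⟩ := D.linked hx hx'
  have hvt : v ∈ bag t := h ⟨hxt, le_rfl⟩
  rcases hT x t y hxt hxy with hty | hyt
  · exact hxt'.trans hty
  rcases eq_or_lt_of_le hyt with rfl | hlt
  · exact hxt'
  · exact absurd ⟨t, hy.2.2 t hlt (D.le_root hvt), hvt⟩ hv

theorem mem_bag_of_isHanging (hT : IsForestOrder T) (D : CliqueDecomposition Γ bag k ρ)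
    {v : V} {x y : T} (hv : v ∈ coreVerts Γ bag ρ) (hx : v ∈ bag x) (hxy : x ≤ y)
    (hy : IsHanging Γ bag ρ y) : v ∈ bag y := by
  obtain ⟨z, hz, hvz⟩ := hv
  exact (D.linked hx hvz).mem_of_le hT hxy fun hzy => hy.2.1 (D.core_upward hT hz hzy hy.1)

/-- Both vertices persist along intervals going strictly above `y`. These are nested, and the lower
of the two tops is a core node containing both. -/
theorem exists_core_bag (hT : IsForestOrder T) (D : CliqueDecomposition Γ bag k ρ)
    {u v : V} {y : T} (hu : u ∈ coreVerts Γ bag ρ) (hv : v ∈ coreVerts Γ bag ρ)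
    (hy : IsHanging Γ bag ρ y) (huy : u ∈ bag y) (hvy : v ∈ bag y) :
    ∃ x ∈ core Γ bag ρ, u ∈ bag x ∧ v ∈ bag x := by
  have key : ∀ w, w ∈ coreVerts Γ bag ρ → w ∈ bag y →
      ∃ t, y < t ∧ t ∈ core Γ bag ρ ∧ w ∈ bag t ∧ Set.Icc y t ⊆ {z | w ∈ bag z} := by
    rintro w ⟨z, hz, hwz⟩ hwy
    obtain ⟨t, hyt, hzt, h, -⟩ := D.linked hwy hwz
    have hwt : w ∈ bag t := h ⟨hyt, le_rfl⟩
    have hlt : y < t := lt_of_le_of_ne hyt fun e =>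
      hy.2.1 (D.core_upward hT hz (e ▸ hzt) hy.1)
    exact ⟨t, hlt, hy.2.2 t hlt (D.le_root hwt), hwt, h⟩
  obtain ⟨t, hyt, ht, hut, hu'⟩ := key u hu huy
  obtain ⟨t', hyt', ht', hvt, hv'⟩ := key v hv hvy
  rcases hT y t t' hyt.le hyt'.le with h | h
  · exact ⟨t, ht, hut, hv' ⟨hyt.le, h⟩⟩
  · exact ⟨t', ht', hu' ⟨hyt'.le, h⟩, hvt⟩

theorem exists_core_bag_of_adj [Finite T] (hT : IsForestOrder T)
    (D : CliqueDecomposition Γ bag k ρ) {u v : V} (hu : u ∈ coreVerts Γ bag ρ)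
    (hv : v ∈ coreVerts Γ bag ρ) (h : Γ.Adj u v) :
    ∃ x ∈ core Γ bag ρ, u ∈ bag x ∧ v ∈ bag x := by
  obtain ⟨x, hux, hvx⟩ := D.edge h
  by_cases hx : x ∈ core Γ bag ρ
  · exact ⟨x, hx, hux, hvx⟩
  obtain ⟨y, hxy, hy⟩ := exists_isHanging (D.le_root hux) hx
  exact D.exists_core_bag hT hu hv hy (D.mem_bag_of_isHanging hT hu hux hxy hy)
    (D.mem_bag_of_isHanging hT hv hvx hxy hy)

theorem nhd_nhd_subset_coreVerts (D : CliqueDecomposition Γ bag k ρ) :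
    Γ.nhd (Γ.nhd (bag ρ)) ⊆ coreVerts Γ bag ρ := by
  have key : ∀ {u x}, u ∈ Γ.nhd (bag ρ) → u ∈ bag x → x ∈ core Γ bag ρ :=
    fun hu hx => ⟨D.le_root hx, Or.inr ⟨_, hx, hu⟩⟩
  rintro v ⟨u, hu, rfl | huv⟩
  · obtain ⟨w, hw, rfl | hwu⟩ := hu
    · exact ⟨ρ, ⟨le_rfl, Or.inl rfl⟩, hw⟩
    · obtain ⟨x, -, hx⟩ := D.edge hwu
      exact ⟨x, key ⟨w, hw, Or.inr hwu⟩ hx, hx⟩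
  · obtain ⟨x, hux, hvx⟩ := D.edge huv
    exact ⟨x, key hu hux, hvx⟩

/-! ### Smaller decompositions for the induction -/

/-- The bags of the core with the second neighbourhood of the root bag removed. -/
def innerBag (Γ : SimpleGraph V) (bag : T → Set V) (ρ x : T) : Set V :=
  {v | x ∈ core Γ bag ρ ∧ v ∈ bag x ∧ v ∉ Γ.nhd (Γ.nhd (bag ρ))}

/-- Two vertices in a common inner bag are adjacent if they are at distance at most `q`. -/
def innerGraph (Γ : SimpleGraph V) (bag : T → Set V) (ρ : T) (q : ℕ) : SimpleGraph V where
  Adj a b := a ≠ b ∧ Γ.edist a b ≤ q ∧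
    ∃ x, a ∈ innerBag Γ bag ρ x ∧ b ∈ innerBag Γ bag ρ x
  symm := ⟨fun a b h => ⟨h.1.symm, by rw [SimpleGraph.edist_comm]; exact h.2.1,
    h.2.2.imp fun _ hx => hx.symm⟩⟩
  loopless := ⟨fun _ h => h.1 rfl⟩

-- This is where a clique is saved: one clique of each nonempty inner bag contains a vertex of
-- `N[B]`, hence lies in the deleted set `N[N[B]]`.
open Classical in
theorem inner (hT : IsForestOrder T) (D : CliqueDecomposition Γ bag (k + 1) ρ) {q : ℕ}
    (hq : 1 ≤ q) : CliqueDecomposition (innerGraph Γ bag ρ q) (innerBag Γ bag ρ) k ρ where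
  le_root h := h.1.1
  edge h := h.2.2
  linked := by
    rintro v x x' ⟨hx, hvx, hv⟩ ⟨hx', hvx', -⟩
    obtain ⟨t, hxt, hxt', h, h'⟩ := D.linked hvx hvx'
    have ht : t ≤ ρ := D.le_root (h ⟨hxt, le_rfl⟩)
    exact ⟨t, hxt, hxt',
      fun z hz => ⟨D.core_upward hT hx hz.1 (hz.2.trans ht), h hz, hv⟩,
      fun z hz => ⟨D.core_upward hT hx' hz.1 (hz.2.trans ht), h' hz, hv⟩⟩
  cliques x := by
    rcases (innerBag Γ bag ρ x).eq_empty_or_nonempty with he | ⟨v, hx, hvx, -⟩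
    · exact ⟨∅, by simp, by simp, by simp [he]⟩
    -- The root is in the core by decree; there the vertex `v` of its own bag serves.
    obtain ⟨w, hw, hwn⟩ : ∃ w ∈ bag x, w ∈ Γ.nhd (bag ρ) := by
      rcases hx.2 with rfl | h
      · exact ⟨v, hvx, Γ.subset_nhd _ hvx⟩
      · exact h
    obtain ⟨𝒦, hcard, hcl, hcov⟩ := D.cliques x
    obtain ⟨K₀, hK₀, hwK₀⟩ := hcov hw
    refine ⟨(𝒦.erase K₀).image (· ∩ innerBag Γ bag ρ x), Finset.card_image_le.trans ?_, ?_, ?_⟩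
    · rw [Finset.card_erase_of_mem hK₀]; omega
    · simp only [Finset.mem_image, forall_exists_index, and_imp, forall_apply_eq_imp_iff₂]
      rintro K hK a ⟨haK, ha⟩ b ⟨hbK, hb⟩ hab
      refine ⟨hab, ?_, x, ha, hb⟩
      calc Γ.edist a b ≤ 1 := by
            rw [SimpleGraph.edist_le_one_iff_adj_or_eq]
            exact Or.inl (hcl K (Finset.mem_of_mem_erase hK) haK hbK hab)
        _ ≤ q := by exact_mod_cast hq
    · intro a ha
      obtain ⟨K, hK, haK⟩ := hcov ha.2.1
      refine ⟨K ∩ innerBag Γ bag ρ x, ?_, haK, ha⟩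
      simp only [Finset.coe_image, Finset.coe_erase, Set.mem_image]
      refine ⟨K, ⟨hK, ?_⟩, rfl⟩
      rintro rfl
      refine ha.2.2 ⟨w, hwn, ?_⟩
      by_cases hwa : w = a
      · exact Or.inl hwa
      · exact Or.inr (hcl _ hK₀ hwK₀ haK hwa)

/-- The bags below `y`. -/
def lowerBag (bag : T → Set V) (y x : T) : Set V :=
  {v | x ≤ y ∧ v ∈ bag x}

/-- The edges of `Γ` in the bags below `y`. -/
def lowerGraph (Γ : SimpleGraph V) (bag : T → Set V) (y : T) : SimpleGraph V where
  Adj a b := Γ.Adj a b ∧ ∃ x, a ∈ lowerBag bag y x ∧ b ∈ lowerBag bag y x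
  symm := ⟨fun _ _ h => ⟨h.1.symm, h.2.imp fun _ hx => hx.symm⟩⟩
  loopless := ⟨fun _ h => h.1.ne rfl⟩

theorem lowerGraph_le (y : T) : lowerGraph Γ bag y ≤ Γ := fun _ _ h => h.1

-- Meeting points above `y` are lowered to `y`, so the restriction keeps bags connected without
-- adding cliques.
open Classical in
theorem lower (hT : IsForestOrder T) (D : CliqueDecomposition Γ bag k ρ) (y : T) :
    CliqueDecomposition (lowerGraph Γ bag y) (lowerBag bag y) k y where
  le_root h := h.1
  edge h := h.2
  linked := by
    rintro v x x' ⟨hx, hvx⟩ ⟨hx', hvx'⟩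
    obtain ⟨t, hxt, hxt', h, h'⟩ := D.linked hvx hvx'
    rcases hT x t y hxt hx with ht | ht
    · exact ⟨t, hxt, hxt', fun z hz => ⟨hz.2.trans ht, h hz⟩, fun z hz => ⟨hz.2.trans ht, h' hz⟩⟩
    · exact ⟨y, hx, hx', fun z hz => ⟨hz.2, h ⟨hz.1, hz.2.trans ht⟩⟩,
        fun z hz => ⟨hz.2, h' ⟨hz.1, hz.2.trans ht⟩⟩⟩
  cliques x := by
    obtain ⟨𝒦, hcard, hcl, hcov⟩ := D.cliques x
    refine ⟨𝒦.image (· ∩ lowerBag bag y x), Finset.card_image_le.trans hcard, ?_, ?_⟩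
    · simp only [Finset.mem_image, forall_exists_index, and_imp, forall_apply_eq_imp_iff₂]
      rintro K hK a ⟨haK, ha⟩ b ⟨hbK, hb⟩ hab
      exact ⟨hcl K hK haK hbK hab, x, ha, hb⟩
    · intro a ha
      obtain ⟨K, hK, haK⟩ := hcov ha.2
      refine ⟨K ∩ lowerBag bag y x, ?_, haK, ha⟩
      simp only [Finset.coe_image, Set.mem_image]
      exact ⟨K, hK, rfl⟩

end CliqueDecomposition

/-! ### Layered colourings and bounds -/

/-- `c` extends the colouring `p` of `B`, its first two layers around `B` have colours `true` and
`false`, and its monochromatic components have weak diameter at most `d`. -/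
structure LayeredColouring {V : Type*} (Γ : SimpleGraph V) (B : Set V) (p : V → Bool) (d : ℕ)
    (c : V → Bool) : Prop where
  root : ∀ v ∈ B, c v = p v
  first : ∀ v ∈ Γ.nhd B, v ∉ B → c v = true
  second : ∀ v ∈ Γ.nhd (Γ.nhd B), v ∉ Γ.nhd B → c v = false
  bounded : ∀ u v, (Γ.mono c).Reachable u v → Γ.edist u v ≤ d

/-- A bound on the weak diameter of the connected subgraphs of the closed neighbourhood of a
bag. -/
def tubeBound (k : ℕ) : ℕ := SimpleGraph.chainBound 0 1 3 k + 1

/-- The bound on the weak diameter of monochromatic components. -/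
def colourBound : ℕ → ℕ
  | 0 => 0
  | k + 1 => 2 * tubeBound (k + 1) + SimpleGraph.chainBound
      (colourBound k * tubeBound (k + 1)) (tubeBound (k + 1)) 5 (k + 1)

namespace SimpleGraph

variable {V : Type*}

/-- The monochromatic edges inside the closed neighbourhood of `B`. -/
def tube (Γ : SimpleGraph V) (B : Set V) (c : V → Bool) : SimpleGraph V :=
  (Γ.mono c).avoid (Γ.nhd B)ᶜ

theorem edist_le_tubeBound {Γ : SimpleGraph V} {B : Set V} {k : ℕ} (hB : Γ.Covered k 1 B)
    {c : V → Bool} {u v : V} (h : (Γ.tube B c).Reachable u v) :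
    Γ.edist u v ≤ tubeBound k := by
  have : Γ.edist u v ≤ chainBound 0 1 3 k := by
    -- Neighbourhoods of cliques have diameter at most `1 + 2 = 3`; outside them the tube has no
    -- edges, whence `e = 0`.
    refine hB.nhd.edist_le_chainBound (fun a b hab => ?_) (fun a b hab => ?_) h
    · rw [Nat.cast_one, edist_le_one_iff_adj_or_eq]
      exact Or.inl hab.1.1
    · rw [reachable_iff_reflTransGen] at hab
      rcases Relation.ReflTransGen.cases_head hab with rfl | ⟨z, hz, -⟩
      · simp
      · exact absurd (by simpa using hz.1.2.1) hz.2.1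
  exact this.trans (by exact_mod_cast Nat.le_succ _)

theorem edist_le_mul {Γ Γ' : SimpleGraph V} {q : ℕ}
    (h : ∀ a b, Γ'.Adj a b → Γ.edist a b ≤ q) {u v : V} {n : ℕ} (huv : Γ'.edist u v ≤ n) :
    Γ.edist u v ≤ (n * q : ℕ) := by
  have key : ∀ {u v} (w : Γ'.Walk u v), Γ.edist u v ≤ (w.length * q : ℕ) := by
    intro u v w
    induction w with
    | nil => simp
    | cons hab p ih => exact edist_le_add (h _ _ hab) ih (by simp [add_mul, add_comm])
  obtain ⟨w, hw⟩ := exists_walk_of_edist_ne_top (ne_top_of_le_ne_top (ENat.natCast_ne_top n) huv)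
  rw [← hw] at huv
  refine (key w).trans ?_
  exact_mod_cast Nat.mul_le_mul_right q (by exact_mod_cast huv)

end SimpleGraph

/-! ### Gluing the colourings -/

namespace CliqueDecomposition

variable {V T : Type*} [PartialOrder T] {Γ : SimpleGraph V} {bag : T → Set V} {k : ℕ} {ρ : T}

/-- Two vertices of the same colour in a common core bag are adjacent if they are at distance at
most `q`. -/
def traceGraph (Γ : SimpleGraph V) (bag : T → Set V) (ρ : T) (q : ℕ) (c : V → Bool) :
    SimpleGraph V where
  Adj a b := a ≠ b ∧ c a = c b ∧ Γ.edist a b ≤ q ∧ ∃ x ∈ core Γ bag ρ, a ∈ bag x ∧ b ∈ bag x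
  symm := ⟨fun a b h => ⟨h.1.symm, h.2.1.symm, by rw [SimpleGraph.edist_comm]; exact h.2.2.1,
    h.2.2.2.imp fun _ hx => ⟨hx.1, hx.2.symm⟩⟩⟩
  loopless := ⟨fun _ h => h.1 rfl⟩

theorem lowerBag_self (bag : T → Set V) (y : T) : lowerBag bag y y = bag y := by
  ext v; simp [lowerBag]

theorem tube_lowerGraph_edist_le (hT : IsForestOrder T) (D : CliqueDecomposition Γ bag k ρ)
    {y : T} {c : V → Bool} {u v : V}
    (h : ((lowerGraph Γ bag y).tube (bag y) c).Reachable u v) :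
    Γ.edist u v ≤ tubeBound k :=
  (SimpleGraph.edist_anti (lowerGraph_le y)).trans
    (SimpleGraph.edist_le_tubeBound (lowerBag_self bag y ▸ (D.lower hT y).covered y) h)

theorem lowerGraph_adj [Finite T] (D : CliqueDecomposition Γ bag k ρ)
    {u v : V} (huv : Γ.Adj u v) (hv : v ∉ coreVerts Γ bag ρ) :
    ∃ x y, IsHanging Γ bag ρ y ∧ x ≤ y ∧ u ∈ bag x ∧ v ∈ bag x ∧
      (lowerGraph Γ bag y).Adj u v := by
  obtain ⟨x, hux, hvx⟩ := D.edge huv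
  obtain ⟨y, hxy, hy⟩ := exists_isHanging (D.le_root hux) fun hx => hv ⟨x, hx, hvx⟩
  exact ⟨x, y, hy, hxy, hux, hvx, huv, x, ⟨hxy, hux⟩, hxy, hvx⟩

section Gluing

variable {c : V → Bool} {cy : T → V → Bool}

/-- Walk along the component, remembering the last core vertex `w`. During an excursion the current
vertex stays in the tube around `bag y`, so a return to the core becomes one trace edge. -/
theorem trace_of_reachable [Finite T] (hT : IsForestOrder T)
    (D : CliqueDecomposition Γ bag k ρ) {p : V → Bool} {d : ℕ}
    (hcy : ∀ y, IsHanging Γ bag ρ y →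
      LayeredColouring (lowerGraph Γ bag y) (bag y) p d (cy y))
    (hc : ∀ x y v, IsHanging Γ bag ρ y → x ≤ y → v ∈ bag x → c v = cy y v)
    {u v : V} (hu : u ∈ coreVerts Γ bag ρ) (huv : (Γ.mono c).Reachable u v) :
    ∃ w, (traceGraph Γ bag ρ (tubeBound k) c).Reachable u w ∧ w ∈ coreVerts Γ bag ρ ∧
      (v = w ∨ v ∉ coreVerts Γ bag ρ ∧ ∃ x y, IsHanging Γ bag ρ y ∧ w ∈ bag y ∧ x ≤ y ∧
        v ∈ bag x ∧ v ∈ (lowerGraph Γ bag y).nhd (bag y) ∧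
        ((lowerGraph Γ bag y).tube (bag y) (cy y)).Reachable w v) := by
  rw [SimpleGraph.reachable_iff_reflTransGen] at huv
  induction huv with
  | refl => exact ⟨u, .refl _, hu, Or.inl rfl⟩
  | @tail b v' _ hbv ih =>
    obtain ⟨hbv, hcol⟩ := hbv
    obtain ⟨w, huw, hw, rfl | ⟨hb, x, y, hy, hwy, hxy, hbx, hbn, hwb⟩⟩ := ih
    · by_cases hv' : v' ∈ coreVerts Γ bag ρ
      · refine ⟨v', huw.trans (SimpleGraph.Adj.reachable ?_), hv', Or.inl rfl⟩
        refine ⟨hbv.ne, hcol, ?_, D.exists_core_bag_of_adj hT hw hv' hbv⟩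
        refine (SimpleGraph.edist_le_one_iff_adj_or_eq.mpr (Or.inl hbv)).trans ?_
        exact_mod_cast Nat.le_add_left 1 _
      · obtain ⟨x, y, hy, hxy, hbx, hvx, hadj⟩ := D.lowerGraph_adj hbv hv'
        have hby := D.mem_bag_of_isHanging hT hw hbx hxy hy
        have hv'n : v' ∈ (lowerGraph Γ bag y).nhd (bag y) := ⟨b, hby, Or.inr hadj⟩
        refine ⟨b, huw, hw, Or.inr ⟨hv', x, y, hy, hby, hxy, hvx, hv'n,
          SimpleGraph.Adj.reachable ⟨⟨hadj, ?_⟩, not_not.mpr (SimpleGraph.subset_nhd _ _ hby),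
            not_not.mpr hv'n⟩⟩⟩
        rw [← hc x y b hy hxy hbx, ← hc x y v' hy hxy hvx, hcol]
    · obtain ⟨x', y', hy', hxy', hvx', hbx', hadj⟩ := D.lowerGraph_adj hbv.symm hb
      obtain rfl : y = y' := hy.unique hT hy'
        ((D.le_of_notMem_coreVerts hT hb hbx hxy hy hbx').trans le_rfl) hxy'
      have hcol' : cy y b = cy y v' := by
        rw [← hc x' y b hy hxy' hbx', ← hc x' y v' hy hxy' hvx', hcol]
      -- Leaving the closed neighbourhood would mean stepping from the `true` layer to the `false`
      -- one.
      have hv'n : v' ∈ (lowerGraph Γ bag y).nhd (bag y) := by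
        by_cases hby : b ∈ bag y
        · exact ⟨b, hby, Or.inr hadj.symm⟩
        by_contra hn
        have h₁ := (hcy y hy).first b hbn hby
        have h₂ := (hcy y hy).second v' ⟨b, hbn, Or.inr hadj.symm⟩ hn
        rw [h₁, h₂] at hcol'
        cases hcol'
      have hwv : ((lowerGraph Γ bag y).tube (bag y) (cy y)).Reachable w v' :=
        hwb.trans (SimpleGraph.Adj.reachable
          ⟨⟨hadj.symm, hcol'⟩, not_not.mpr hbn, not_not.mpr hv'n⟩)
      by_cases hv' : v' ∈ coreVerts Γ bag ρ
      · refine ⟨v', huw.trans ?_, hv', Or.inl rfl⟩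
        by_cases hne : w = v'
        · rw [hne]
        have hv'y := D.mem_bag_of_isHanging hT hv' hvx' hxy' hy
        refine SimpleGraph.Adj.reachable ⟨hne, ?_, D.tube_lowerGraph_edist_le hT hwv,
          D.exists_core_bag hT hw hv' hy hwy hv'y⟩
        have : ∀ {a b}, ((lowerGraph Γ bag y).tube (bag y) (cy y)).Reachable a b →
            cy y a = cy y b := by
          intro a b hab
          rw [SimpleGraph.reachable_iff_reflTransGen] at hab
          induction hab with
          | refl => rfl
          | tail _ h ih => exact ih.trans h.1.2
        rw [hc y y w hy le_rfl hwy, hc y y v' hy le_rfl hv'y, this hwv]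
      · exact ⟨w, huw, hw, Or.inr ⟨hv', x', y, hy, hwy, hxy', hvx', hv'n, hwv⟩⟩

/-- Outside the core vertices, an edge cannot change hanging subtree, because all bags of such a
vertex lie below the same hanging node. -/
theorem reachable_meets_core_or_lower [Finite T] (hT : IsForestOrder T)
    (D : CliqueDecomposition Γ bag k ρ)
    (hc : ∀ x y v, IsHanging Γ bag ρ y → x ≤ y → v ∈ bag x → c v = cy y v)
    {u v : V} (huv : (Γ.mono c).Reachable u v) :
    u = v ∨ (∃ w ∈ coreVerts Γ bag ρ, (Γ.mono c).Reachable w u) ∨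
      ∃ x y, IsHanging Γ bag ρ y ∧ x ≤ y ∧ v ∈ bag x ∧ v ∉ coreVerts Γ bag ρ ∧
        ((lowerGraph Γ bag y).mono (cy y)).Reachable u v := by
  have h' := huv
  rw [SimpleGraph.reachable_iff_reflTransGen] at h'
  induction h' with
  | refl => exact Or.inl rfl
  | @tail b v' hub hbv ih =>
    right
    rw [← SimpleGraph.reachable_iff_reflTransGen] at hub
    by_cases hb : b ∈ coreVerts Γ bag ρ
    · exact Or.inl ⟨b, hb, hub.symm⟩
    by_cases hv' : v' ∈ coreVerts Γ bag ρ
    · exact Or.inl ⟨v', hv', huv.symm⟩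
    obtain ⟨x', y', hy', hxy', hbx', hvx', hadj⟩ := D.lowerGraph_adj hbv.1 hv'
    have hstep : ((lowerGraph Γ bag y').mono (cy y')).Reachable b v' :=
      SimpleGraph.Adj.reachable ⟨hadj, by
        rw [← hc x' y' b hy' hxy' hbx', ← hc x' y' v' hy' hxy' hvx', hbv.2]⟩
    rcases ih hub with rfl | ih | ⟨x, y, hy, hxy, hbx, -, hreach⟩
    · exact Or.inr ⟨x', y', hy', hxy', hvx', hv', hstep⟩
    · exact Or.inl ih
    · obtain rfl : y = y' := hy.unique hT hy'
        (D.le_of_notMem_coreVerts hT hb hbx hxy hy hbx') hxy'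
      exact Or.inr ⟨x', y, hy, hxy', hvx', hv', hreach.trans hstep⟩

theorem edist_le_of_glued [Finite T] (hT : IsForestOrder T)
    (D : CliqueDecomposition Γ bag (k + 1) ρ) {p cH : V → Bool}
    (hcH : ∀ u v, ((innerGraph Γ bag ρ (tubeBound (k + 1))).mono cH).Reachable u v →
      (innerGraph Γ bag ρ (tubeBound (k + 1))).edist u v ≤ colourBound k)
    (hcore : ∀ v ∈ coreVerts Γ bag ρ, v ∉ Γ.nhd (Γ.nhd (bag ρ)) → c v = cH v)
    (hcy : ∀ y, IsHanging Γ bag ρ y →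
      LayeredColouring (lowerGraph Γ bag y) (bag y) p (colourBound (k + 1)) (cy y))
    (hc : ∀ x y v, IsHanging Γ bag ρ y → x ≤ y → v ∈ bag x → c v = cy y v)
    {u v : V} (huv : (Γ.mono c).Reachable u v) : Γ.edist u v ≤ colourBound (k + 1) := by
  rcases D.reachable_meets_core_or_lower hT hc huv with rfl | ⟨w, hw, hwu⟩ |
    ⟨x, y, hy, -, -, -, h⟩
  · simp
  · have near : ∀ {z}, (Γ.mono c).Reachable w z →
        ∃ z', (traceGraph Γ bag ρ (tubeBound (k + 1)) c).Reachable w z' ∧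
          Γ.edist z' z ≤ tubeBound (k + 1) := by
      intro z hz
      obtain ⟨z', hwz, -, rfl | ⟨-, x, y, -, -, -, -, -, h⟩⟩ :=
        D.trace_of_reachable hT hcy hc hw hz
      · exact ⟨z, hwz, by simp⟩
      · exact ⟨z', hwz, D.tube_lowerGraph_edist_le hT h⟩
    obtain ⟨u', hwu', hu'⟩ := near hwu
    obtain ⟨v', hwv', hv'⟩ := near (hwu.trans huv)
    have hmid : Γ.edist u' v' ≤ SimpleGraph.chainBound
        (colourBound k * tubeBound (k + 1)) (tubeBound (k + 1)) 5 (k + 1) := by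
      -- Two neighbourhoods raise the clique diameter from `1` to `5`. Off them, trace edges are
      -- monochromatic inner edges, each of `Γ`-length at most `tubeBound (k + 1)`.
      refine (D.covered ρ).nhd.nhd.edist_le_chainBound (Q := traceGraph Γ bag ρ (tubeBound (k + 1)) c)
        (fun a b hab => hab.2.2.1) (fun a b hab => ?_) (hwu'.symm.trans hwv')
      refine SimpleGraph.edist_le_mul
        (Γ' := innerGraph Γ bag ρ (tubeBound (k + 1))) (fun a b h => h.2.1) (hcH a b (hab.mono ?_))
      rintro a b ⟨⟨hne, hcol, hd, x, hx, hax, hbx⟩, ha, hb⟩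
      refine ⟨⟨hne, hd, x, ⟨hx, hax, ha⟩, hx, hbx, hb⟩, ?_⟩
      rw [← hcore a ⟨x, hx, hax⟩ ha, ← hcore b ⟨x, hx, hbx⟩ hb, hcol]
    rw [SimpleGraph.edist_comm] at hu'
    exact SimpleGraph.edist_le_add (SimpleGraph.edist_le_add hu' hmid le_rfl) hv'
      (by simp only [colourBound]; omega)
  · exact (SimpleGraph.edist_anti (lowerGraph_le y)).trans ((hcy y hy).bounded u v h)

end Gluing

open Classical in
theorem exists_layeredColouring [Finite T] (hT : IsForestOrder T) (k : ℕ) :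
    ∀ (ρ : T) (Γ : SimpleGraph V) (bag : T → Set V), CliqueDecomposition Γ bag k ρ →
      ∀ p : V → Bool, ∃ c, LayeredColouring Γ (bag ρ) p (colourBound k) c := by
  induction k with
  | zero =>
    intro ρ Γ bag D p
    have hempty : ∀ x, bag x = ∅ := by
      intro x
      obtain ⟨𝒦, hcard, -, hcov⟩ := D.cliques x
      obtain rfl : 𝒦 = ∅ := Finset.card_eq_zero.mp (by omega)
      simpa using hcov
    have hn : ∀ v, v ∉ Γ.nhd ∅ := by rintro v ⟨u, hu, -⟩; exact hu
    refine ⟨p, fun _ _ => rfl, fun v hv => ?_, ?_, fun u v huv => ?_⟩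
    · rw [hempty] at hv; exact absurd hv (hn v)
    · rintro v ⟨u, hu, -⟩
      rw [hempty] at hu; exact absurd hu (hn u)
    · rw [SimpleGraph.reachable_iff_reflTransGen] at huv
      rcases Relation.ReflTransGen.cases_head huv with rfl | ⟨z, hz, -⟩
      · simp
      · obtain ⟨x, hx, -⟩ := D.edge hz.1
        rw [hempty] at hx; exact hx.elim
  | succ k ihk =>
    intro ρ
    induction ρ using (Finite.to_wellFoundedLT (α := T)).wf.induction with
    | _ ρ ih =>
    intro Γ bag D p
    obtain ⟨cH, -, -, -, hcH⟩ := ihk ρ _ _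
      (D.inner hT (q := tubeBound (k + 1)) (Nat.le_add_left 1 _)) (fun _ => true)
    -- The prescribed layers override `cH`; they lie in the deleted set, where `cH` is never used.
    let c₀ : V → Bool := fun v => if v ∈ bag ρ then p v else
      if v ∈ Γ.nhd (bag ρ) then true else if v ∈ Γ.nhd (Γ.nhd (bag ρ)) then false else cH v
    have hex : ∀ y, ∃ cy, IsHanging Γ bag ρ y →
        LayeredColouring (lowerGraph Γ bag y) (bag y) c₀ (colourBound (k + 1)) cy := by
      intro y
      by_cases hy : IsHanging Γ bag ρ y
      · obtain ⟨cy, hcy⟩ := ih y hy.lt _ _ (D.lower hT y) c₀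
        exact ⟨cy, fun _ => lowerBag_self bag y ▸ hcy⟩
      · exact ⟨c₀, fun h => absurd h hy⟩
    choose cy hcy using hex
    have hex : ∀ v, ∃ y, v ∉ coreVerts Γ bag ρ → ∀ x y', IsHanging Γ bag ρ y' → x ≤ y' →
        v ∈ bag x → y = y' := by
      intro v
      by_cases h : ∃ x y, IsHanging Γ bag ρ y ∧ x ≤ y ∧ v ∈ bag x
      · obtain ⟨x, y, hy, hxy, hvx⟩ := h
        exact ⟨y, fun hv x' y' hy' hxy' hvx' => hy.unique hT hy'
          (D.le_of_notMem_coreVerts hT hv hvx hxy hy hvx') hxy'⟩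
      -- No hanging subtree contains `v`, so the choice of `ρ` is immaterial.
      · exact ⟨ρ, fun _ x y hy hxy hvx => absurd ⟨x, y, hy, hxy, hvx⟩ h⟩
    choose Y hY using hex
    let c : V → Bool := fun v => if v ∈ coreVerts Γ bag ρ then c₀ v else cy (Y v) v
    have hc_core : ∀ v ∈ coreVerts Γ bag ρ, c v = c₀ v := fun v hv => if_pos hv
    have hc : ∀ x y v, IsHanging Γ bag ρ y → x ≤ y → v ∈ bag x → c v = cy y v := by
      intro x y v hy hxy hvx
      by_cases hv : v ∈ coreVerts Γ bag ρ
      · rw [hc_core v hv, (hcy y hy).root v (D.mem_bag_of_isHanging hT hv hvx hxy hy)]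
      · simp only [c, if_neg hv, hY v hv x y hy hxy hvx]
    have hsub := D.nhd_nhd_subset_coreVerts
    have hsub₁ : Γ.nhd (bag ρ) ⊆ coreVerts Γ bag ρ := (Γ.subset_nhd _).trans hsub
    have hsub₀ : bag ρ ⊆ coreVerts Γ bag ρ := (Γ.subset_nhd _).trans hsub₁
    refine ⟨c, fun v hv => ?_, fun v hv hv' => ?_, fun v hv hv' => ?_, fun u v huv => ?_⟩
    · rw [hc_core v (hsub₀ hv)]; exact if_pos hv
    · rw [hc_core v (hsub₁ hv)]; simp only [c₀, if_neg hv', if_pos hv]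
    · have : v ∉ bag ρ := fun h => hv' (Γ.subset_nhd _ h)
      rw [hc_core v (hsub hv)]; simp only [c₀, if_neg this, if_neg hv', if_pos hv]
    · refine D.edist_le_of_glued hT hcH (fun v hv hv' => ?_) hcy hc huv
      have h₁ : v ∉ Γ.nhd (bag ρ) := fun h => hv' (Γ.subset_nhd _ h)
      have h₀ : v ∉ bag ρ := fun h => h₁ (Γ.subset_nhd _ h)
      rw [hc_core v hv]; simp only [c₀, if_neg h₀, if_neg h₁, if_neg hv']

end CliqueDecomposition

/-! ### Trees as forest orders -/

namespace SimpleGraph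

variable {T : Type*} {H : SimpleGraph T}

/-- `y` separates `x` from the root `ρ`. -/
def Dominated (H : SimpleGraph T) (ρ x y : T) : Prop :=
  ∀ p : H.Walk x ρ, y ∈ p.support

theorem Dominated.trans {ρ x y z : T} (h₁ : H.Dominated ρ x y) (h₂ : H.Dominated ρ y z) :
    H.Dominated ρ x z := by
  classical
  exact fun p => p.support_dropUntil_subset_support (h₁ p) (h₂ _)

theorem Dominated.dist_root_le (hH : H.Connected) {ρ x y : T} (h : H.Dominated ρ x y) :
    H.dist y ρ ≤ H.dist x ρ := by
  classical
  obtain ⟨p, hp⟩ := hH.exists_walk_length_eq_dist x ρ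
  rw [← hp]
  exact (dist_le _).trans (p.length_dropUntil_le_length (h p))

theorem Dominated.eq_of_dist_le (hH : H.Connected) {ρ x y : T} (h : H.Dominated ρ x y)
    (hd : H.dist x ρ ≤ H.dist y ρ) : x = y := by
  classical
  obtain ⟨p, hp⟩ := hH.exists_walk_length_eq_dist x ρ
  have h₁ := congrArg Walk.length (p.take_spec (h p))
  rw [Walk.length_append] at h₁
  have h₂ := dist_le (p.dropUntil y (h p))
  exact Walk.eq_of_length_eq_zero (p := p.takeUntil y (h p)) (by omega)

/-- The order on the nodes of a connected graph in which `x ≤ y` if `y` separates `x` from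
the root. -/
@[reducible]
def rootedOrder (hH : H.Connected) (ρ : T) : PartialOrder T where
  le := H.Dominated ρ
  le_refl _ p := p.start_mem_support
  le_trans _ _ _ := Dominated.trans
  le_antisymm _ _ h h' := h.eq_of_dist_le hH (h'.dist_root_le hH)

/-- Distance to the root decides. If `y` is no farther than `z`, a shortest walk from `x` meets `y`
before `z` only when `y = z`; rerouting its start along any walk from `z` shows that `y` dominates
`z`. -/
theorem isForestOrder_rootedOrder (hH : H.Connected) (ρ : T) :
    @IsForestOrder T (rootedOrder hH ρ) := by
  classical
  have key : ∀ x y z, H.Dominated ρ x y → H.Dominated ρ x z → H.dist y ρ ≤ H.dist z ρ →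
      H.Dominated ρ z y := by
    intro x y z hy hz hd w
    obtain ⟨p, hp⟩ := hH.exists_walk_length_eq_dist x ρ
    have hmem := hy ((p.takeUntil z (hz p)).append w)
    rw [Walk.mem_support_append_iff] at hmem
    rcases hmem with hmem | hmem
    · have h₁ := congrArg Walk.length (p.take_spec (hz p))
      have h₂ := congrArg Walk.length ((p.takeUntil z (hz p)).take_spec hmem)
      rw [Walk.length_append] at h₁ h₂
      have h₃ := dist_le (p.dropUntil z (hz p))
      have h₄ := dist_le ((((p.takeUntil z (hz p)).takeUntil y hmem)).append
        (hH.exists_walk_length_eq_dist y ρ).choose)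
      rw [Walk.length_append, (hH.exists_walk_length_eq_dist y ρ).choose_spec] at h₄
      obtain rfl := Walk.eq_of_length_eq_zero
        (p := (p.takeUntil z (hz p)).dropUntil y hmem) (by omega)
      exact w.start_mem_support
    · exact hmem
  intro x y z hy hz
  rcases le_total (H.dist y ρ) (H.dist z ρ) with h | h
  · exact Or.inr (key x y z hy hz h)
  · exact Or.inl (key x z y hz hy h)

/-- Otherwise two walks to the root would bypass the edge `ab`, which is a bridge. -/
theorem IsTree.dominated_or_dominated (hH : H.IsTree) (ρ : T) {a b : T} (hab : H.Adj a b) :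
    H.Dominated ρ a b ∨ H.Dominated ρ b a := by
  by_contra! h
  simp only [Dominated, not_forall] at h
  obtain ⟨⟨p, hp⟩, q, hq⟩ := h
  have hb := isAcyclic_iff_forall_adj_isBridge.mp hH.isAcyclic hab
  have := isBridge_iff_forall_walk_mem_edges.mp hb (p.append q.reverse)
  rw [Walk.edges_append, List.mem_append, Walk.edges_reverse, List.mem_reverse] at this
  rcases this with h | h
  · exact hp (p.snd_mem_support_of_mem_edges h)
  · exact hq (q.fst_mem_support_of_mem_edges h)

theorem IsTree.linked_of_adj (hH : H.IsTree) (ρ : T) {S : Set T} {a b : T} (hab : H.Adj a b)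
    (ha : a ∈ S) (hb : b ∈ S) : @Linked T (rootedOrder hH.connected ρ) S a b := by
  let _ := rootedOrder hH.connected ρ
  have key : ∀ {a b : T}, H.Adj a b → a ∈ S → b ∈ S → H.Dominated ρ a b → Linked S a b := by
    intro a b hab ha hb hle
    refine ⟨b, hle, le_rfl, ?_, ?_⟩
    · rintro z ⟨hz₁ : H.Dominated ρ a z, hz₂ : H.Dominated ρ z b⟩
      have h₁ := hz₁.dist_root_le hH.connected
      have h₂ := hz₂.dist_root_le hH.connected
      have h₃ : H.dist a ρ ≤ H.dist a b + H.dist b ρ := hH.connected.dist_triangle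
      rw [dist_eq_one_iff_adj.mpr hab] at h₃
      by_cases h : H.dist z ρ ≤ H.dist b ρ
      · rwa [hz₂.eq_of_dist_le hH.connected h]
      · rwa [← hz₁.eq_of_dist_le hH.connected (by omega)]
    · intro z hz
      rw [Set.Icc_self, Set.mem_singleton_iff] at hz
      rwa [hz]
  rcases hH.dominated_or_dominated ρ hab with h | h
  · exact key hab ha hb h
  · exact (key hab.symm hb ha h).symm

theorem IsTree.linked_of_connected (hH : H.IsTree) (ρ : T) {S : Set T}
    (hS : (H.induce S).Connected) {a b : T} (ha : a ∈ S) (hb : b ∈ S) :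
    @Linked T (rootedOrder hH.connected ρ) S a b := by
  let _ := rootedOrder hH.connected ρ
  have h := hS.preconnected ⟨a, ha⟩ ⟨b, hb⟩
  rw [reachable_iff_reflTransGen] at h
  have key : ∀ c : S, Relation.ReflTransGen (H.induce S).Adj ⟨a, ha⟩ c → Linked S a c := by
    intro c hc
    induction hc with
    | refl =>
      refine ⟨a, le_rfl, le_rfl, ?_, ?_⟩ <;>
      · intro z hz
        rw [Set.Icc_self, Set.mem_singleton_iff] at hz
        rwa [hz]
    | @tail c d _ hcd ih =>
      exact ih.trans (isForestOrder_rootedOrder hH.connected ρ)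
        (hH.linked_of_adj ρ hcd c.2 d.2)
  exact key ⟨b, hb⟩ h

theorem exists_hDecomposition_of_treewidth_le {V : Type*} [Finite V] {G : SimpleGraph V} {k : ℕ}
    (h : G.treewidth ≤ k) :
    ∃ (T : Type) (_ : Finite T) (H : SimpleGraph T) (_ : H.IsTree) (D : G.HDecomposition H),
      ∀ x, (D.bag x).card ≤ k + 1 := by
  have hmem : G.treewidth ∈ {w : ℤ | ∃ (T : Type) (_ : Finite T) (H : SimpleGraph T)
      (_ : H.IsTree) (D : G.HDecomposition H), D.width = w} := by
    refine Int.csInf_mem ?_ ⟨-1, ?_⟩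
    · have := Fintype.ofFinite V
      refine ⟨_, Unit, inferInstance, ⊥, .of_subsingleton, ⟨fun _ => Finset.univ, ?_, ?_⟩, rfl⟩
      · intro v
        have : Nonempty {x : Unit | v ∈ (Finset.univ : Finset V)} := ⟨⟨(), Finset.mem_univ v⟩⟩
        exact ⟨SimpleGraph.Preconnected.of_subsingleton⟩
      · exact fun u v _ => ⟨(), Finset.mem_univ u, Finset.mem_univ v⟩
    · rintro w ⟨T, hT, H, hH, D, rfl⟩
      simp only [HDecomposition.width]
      omega
  obtain ⟨T, hT, H, hH, D, hD⟩ := hmem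
  refine ⟨T, hT, H, hH, D, fun x => ?_⟩
  rw [← hD] at h
  have h₁ : (D.bag x).card ≤ ⨆ x, (D.bag x).card :=
    le_ciSup (f := fun x => (D.bag x).card) (Set.finite_range _).bddAbove x
  simp only [HDecomposition.width] at h
  omega

end SimpleGraph

/-! ### Thickening the bags of the quotient -/

namespace WeightedGraph

variable {V : Type*}

theorem walkLength_append (G : WeightedGraph V) {u v w : V} (p : G.graph.Walk u v)
    (q : G.graph.Walk v w) : G.walkLength (p.append q) = G.walkLength p + G.walkLength q := by
  simp [walkLength]

theorem dist_le_walkLength (G : WeightedGraph V) {u v : V} (p : G.graph.Walk u v) :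
    G.dist u v ≤ G.walkLength p := by
  classical
  exact (iInf_le _ ⟨p.bypass, p.bypass_isPath⟩).trans
    ((p.darts_bypass_sublist_darts.map _).sum_le_sum fun _ _ => zero_le)

theorem dist_self (G : WeightedGraph V) (u : V) : G.dist u u = 0 :=
  le_antisymm ((G.dist_le_walkLength .nil).trans (by simp [walkLength])) zero_le

theorem dist_triangle (G : WeightedGraph V) (u v w : V) :
    G.dist u w ≤ G.dist u v + G.dist v w := by
  rw [dist, dist, dist, ENNReal.iInf_add]
  refine le_iInf fun p => ?_
  rw [ENNReal.add_iInf]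
  refine le_iInf fun q => ?_
  rw [← walkLength_append]
  exact G.dist_le_walkLength _

theorem exists_walkLength_le [Finite V] (G : WeightedGraph V) {u v : V} {r : ℝ≥0∞} (hr : r ≠ ⊤)
    (h : G.dist u v ≤ r) : ∃ p : G.graph.Walk u v, G.walkLength p ≤ r := by
  classical
  have := Fintype.ofFinite V
  rcases isEmpty_or_nonempty (G.graph.Path u v) with he | he
  · rw [dist, iInf_of_empty] at h
    exact absurd (top_le_iff.mp h) hr
  · obtain ⟨p, hp⟩ := exists_eq_ciInf_of_finite (f := fun p : G.graph.Path u v => G.walkLength p.1)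
    exact ⟨p.1, hp.le.trans h⟩

theorem dist_le_of_mem_support (G : WeightedGraph V) {u v w : V} (p : G.graph.Walk u v)
    (hw : w ∈ p.support) : G.dist u w ≤ G.walkLength p := by
  classical
  rw [← p.take_spec hw, walkLength_append]
  exact (G.dist_le_walkLength _).trans le_self_add

theorem dist_le_dist_induce (G : WeightedGraph V) {S : Set V} (u v : S) :
    G.dist u v ≤ (G.induce S).dist u v := by
  refine le_iInf fun p => ?_
  have h : ∀ {a b : S} (q : (G.induce S).graph.Walk a b),
      G.walkLength (q.map (SimpleGraph.Embedding.induce S).toHom) = (G.induce S).walkLength q := by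
    intro a b q
    induction q with
    | nil => rfl
    | cons hab q ih => exact congrArg (_ + ·) ih
  rw [← h]
  exact G.dist_le_walkLength _

theorem exists_center [Finite V] (G : WeightedGraph V) {S : Set V} (hS : S.Nonempty)
    {r : ℝ≥0∞} (h : (G.induce S).radius ≤ r) : ∃ c, ∀ v ∈ S, G.dist c v ≤ r := by
  have := hS.to_subtype
  obtain ⟨c, hc⟩ := exists_eq_ciInf_of_finite (f := fun u : S => ⨆ v, (G.induce S).dist u v)
  refine ⟨c, fun v hv => ?_⟩
  calc G.dist c v ≤ (G.induce S).dist c ⟨v, hv⟩ := G.dist_le_dist_induce c ⟨v, hv⟩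
    _ ≤ ⨆ v, (G.induce S).dist c v := le_iSup (fun v => (G.induce S).dist c v) _
    _ ≤ r := hc.le.trans h

section Thickening

variable {T : Type*} {H : SimpleGraph T} {G : WeightedGraph V} {π : G.Partition}

/-- The vertices at distance at most `r` from a vertex whose part belongs to the bag of `x`. -/
def thickBag (G : WeightedGraph V) {P : Type*} (part : V → P) (bag : T → Finset P) (r : ℝ)
    (x : T) : Set V :=
  {v | ∃ u, G.dist v u ≤ ENNReal.ofReal r ∧ part u ∈ bag x}

/-- Two vertices in a common bag are adjacent if they are at distance at most `4 * r`. -/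
def thickGraph (G : WeightedGraph V) (bag : T → Set V) (r : ℝ) : SimpleGraph V where
  Adj a b := a ≠ b ∧ G.dist a b ≤ 4 * ENNReal.ofReal r ∧ ∃ x, a ∈ bag x ∧ b ∈ bag x
  symm := ⟨fun a b h => ⟨h.1.symm, by rw [G.dist_comm]; exact h.2.1,
    h.2.2.imp fun _ hx => hx.symm⟩⟩
  loopless := ⟨fun _ h => h.1 rfl⟩

theorem dist_le_of_edist_le {bag : T → Set V} {r : ℝ} {u v : V} {n : ℕ}
    (h : (G.thickGraph bag r).edist u v ≤ n) :
    G.dist u v ≤ n * (4 * ENNReal.ofReal r) := by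
  have key : ∀ {u v} (p : (G.thickGraph bag r).Walk u v),
      G.dist u v ≤ p.length * (4 * ENNReal.ofReal r) := by
    intro u v p
    induction p with
    | nil => simp [G.dist_self]
    | @cons a b c hab p ih =>
      refine (G.dist_triangle a b c).trans ((add_le_add hab.2.1 ih).trans_eq ?_)
      rw [SimpleGraph.Walk.length_cons]; push_cast; ring
  obtain ⟨p, hp⟩ := SimpleGraph.exists_walk_of_edist_ne_top
    (ne_top_of_le_ne_top (ENat.natCast_ne_top n) h)
  rw [← hp] at h
  refine (key p).trans ?_
  gcongr
  exact_mod_cast h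

/-- A short path from `v` to `u` stays in the `r`-ball around `v`, and consecutive parts on it share
a bag, so their subtrees join up. -/
theorem linked_thickBag [Finite V] (hH : H.IsTree) (ρ : T) (D : π.quotient.HDecomposition H)
    {part : V → π.parts} (hpart : ∀ v, v ∈ (part v).1) {r : ℝ} {v : V} {x y : T}
    (hx : v ∈ G.thickBag part D.bag r x) (hy : v ∈ G.thickBag part D.bag r y) :
    @Linked T (SimpleGraph.rootedOrder hH.connected ρ) {z | v ∈ G.thickBag part D.bag r z} x y := by
  let _ := SimpleGraph.rootedOrder hH.connected ρ
  have hT : IsForestOrder T := SimpleGraph.isForestOrder_rootedOrder hH.connected ρ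
  set S := {z | v ∈ G.thickBag part D.bag r z}
  have one : ∀ {a x y}, G.dist v a ≤ ENNReal.ofReal r → part a ∈ D.bag x → part a ∈ D.bag y →
      Linked S x y := fun {a x y} ha hx hy =>
    (hH.linked_of_connected ρ (D.connected (part a)) hx hy).mono fun z hz =>
      show v ∈ G.thickBag part D.bag r z from ⟨a, ha, hz⟩
  have walk : ∀ {a b} (p : G.graph.Walk a b), (∀ w ∈ p.support, G.dist v w ≤ ENNReal.ofReal r) →
      ∀ {x y}, part a ∈ D.bag x → part b ∈ D.bag y → Linked S x y := by
    intro a b p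
    induction p with
    | nil => intro hp x y hx hy; exact one (hp _ (by simp)) hx hy
    | @cons a b c hab p ih =>
      intro hp x y hx hy
      have hp' : ∀ w ∈ p.support, G.dist v w ≤ ENNReal.ofReal r :=
        fun w hw => hp w (by simp [hw])
      by_cases he : part a = part b
      · exact ih hp' (he ▸ hx) hy
      obtain ⟨z, haz, hbz⟩ := D.edge (part a) (part b) ⟨he, a, hpart a, b, hpart b, hab⟩
      exact (one (hp a (by simp)) hx haz).trans hT (ih hp' hbz hy)
  obtain ⟨⟨z, hz⟩⟩ := (D.connected (part v)).nonempty
  have from_v : ∀ {x}, v ∈ G.thickBag part D.bag r x → Linked S z x := by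
    rintro x ⟨u, hu, hux⟩
    obtain ⟨p, hp⟩ := G.exists_walkLength_le ENNReal.ofReal_ne_top hu
    exact walk p (fun w hw => (G.dist_le_of_mem_support p hw).trans hp) hz hux
  exact (from_v hx).symm.trans hT (from_v hy)

open Classical in
theorem cliqueDecomposition_thickGraph [Finite V] (hH : H.IsTree) (ρ : T)
    (D : π.quotient.HDecomposition H) {k : ℕ} (hk : ∀ x, (D.bag x).card ≤ k) {r : ℝ}
    (hπ : π.IsShallow r) {part : V → π.parts} (hpart : ∀ v, v ∈ (part v).1) :
    @CliqueDecomposition V T (SimpleGraph.rootedOrder hH.connected ρ)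
      (G.thickGraph (G.thickBag part D.bag r) r) (G.thickBag part D.bag r) k ρ := by
  let _ := SimpleGraph.rootedOrder hH.connected ρ
  refine ⟨fun _ p => p.end_mem_support, fun h => h.2.2,
    fun hx hy => linked_thickBag hH ρ D hpart hx hy, fun x => ?_⟩
  let K : π.parts → Set V := fun P =>
    {v | v ∈ G.thickBag part D.bag r x ∧ ∃ u, G.dist v u ≤ ENNReal.ofReal r ∧ part u = P}
  refine ⟨(D.bag x).image K, Finset.card_image_le.trans (hk x), ?_, ?_⟩
  · simp only [Finset.mem_image, forall_exists_index, and_imp, forall_apply_eq_imp_iff₂]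
    rintro P - a ⟨hax, u, hau, rfl⟩ b ⟨hbx, w, hbw, hwu⟩ hab
    refine ⟨hab, ?_, x, hax, hbx⟩
    obtain ⟨c, hc⟩ := G.exists_center ⟨u, hpart u⟩ (hπ _ (part u).2)
    have hcu := hc u (hpart u)
    have hcw := hc w (hwu ▸ hpart w)
    rw [G.dist_comm] at hcu hbw
    -- The factor 4: into the part, to its centre, away from the centre, out of the part.
    calc G.dist a b ≤ G.dist a u + (G.dist u c + (G.dist c w + G.dist w b)) :=
          (G.dist_triangle a u b).trans (add_le_add_right ((G.dist_triangle u c b).trans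
            (add_le_add_right (G.dist_triangle c w b) _)) _)
      _ ≤ ENNReal.ofReal r + (ENNReal.ofReal r + (ENNReal.ofReal r + ENNReal.ofReal r)) := by
          gcongr
      _ = 4 * ENNReal.ofReal r := by ring
  · rintro v ⟨u, hu, hux⟩
    refine ⟨K (part u), ?_, ⟨u, hu, hux⟩, u, hu, rfl⟩
    simp only [Finset.coe_image, Set.mem_image]
    exact ⟨part u, hux, rfl⟩

end Thickening

theorem exists_isColouring [Finite V] (G : WeightedGraph V) {π : G.Partition} {k : ℕ} {r : ℝ}
    (hr : 0 < r) (hπ : π.IsKLPartition k r) :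
    ∃ c : V → Fin 2, G.IsColouring 2 r ((4 * colourBound (k + 1) + 1) * r) c := by
  obtain ⟨T, _, H, hH, D, hD⟩ := SimpleGraph.exists_hDecomposition_of_treewidth_le hπ.2
  obtain ⟨ρ⟩ := hH.connected.nonempty
  have hex : ∀ v, ∃ P : π.parts, v ∈ P.1 := fun v => by
    obtain ⟨P, hP, -⟩ := π.isPartition.2 v
    exact ⟨⟨P, hP.1⟩, hP.2⟩
  choose part hpart using hex
  let _ := SimpleGraph.rootedOrder hH.connected ρ
  obtain ⟨c, hc⟩ := CliqueDecomposition.exists_layeredColouring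
    (SimpleGraph.isForestOrder_rootedOrder hH.connected ρ) (k + 1) ρ _ _
    (cliqueDecomposition_thickGraph hH ρ D hD hπ.1 hpart) fun _ => true
  refine ⟨fun v => if c v then 1 else 0, fun i M hM => iSup₂_le fun u hu => iSup₂_le fun v hv => ?_⟩
  have hcol : ∀ {a b}, a ∈ M.verts → b ∈ M.verts → c a = c b := by
    intro a b ha hb
    have := (hM.prop.2 a ha).trans (hM.prop.2 b hb).symm
    cases hca : c a <;> cases hcb : c b <;> simp_all
  have hreach := hM.prop.1.coe.preconnected ⟨u, hu⟩ ⟨v, hv⟩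
  have key : ((G.thickGraph (G.thickBag part D.bag r) r).mono c).Reachable u v := by
    rw [SimpleGraph.reachable_iff_reflTransGen] at hreach ⊢
    -- Any bag containing the part of `a` captures, once thickened, all vertices within `r` of `a`.
    refine Relation.ReflTransGen.lift (fun w : M.verts => w.1) (fun a b hab => ?_) _ _ hreach
    obtain ⟨hne, hd⟩ : (G.power r).Adj a b := M.adj_sub hab
    obtain ⟨⟨z, hz⟩⟩ := (D.connected (part a)).nonempty
    refine ⟨⟨hne, hd.trans ?_, z, ⟨a, by simp [G.dist_self], hz⟩, a, ?_, hz⟩, hcol a.2 b.2⟩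
    · exact le_mul_of_one_le_left zero_le (by norm_num)
    · rwa [G.dist_comm]
  refine (dist_le_of_edist_le (hc.bounded u v key)).trans ?_
  rw [← ENNReal.ofReal_natCast, ← ENNReal.ofReal_ofNat 4, ← ENNReal.ofReal_mul (by norm_num),
    ← ENNReal.ofReal_mul (by positivity)]
  exact ENNReal.ofReal_le_ofReal (by nlinarith)

end WeightedGraph

theorem mainTheorem7 (k : ℕ) :
    ∃ f : Set.Ioi (0 : ℝ) → Set.Ioi (0 : ℝ), IsDilation f ∧
      ∀ ℓ : ℝ, 0 ≤ ℓ →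
        ∀ (V : Type*) [Finite V] (G : WeightedGraph V),
          (∃ π : G.Partition, π.IsKLPartition k ℓ) →
            G.IsAlmostControlFunction ℓ 1 f := by
  -- The added 1 makes the factor visibly positive.
  refine ⟨fun r => ⟨(4 * colourBound (k + 1) + 1) * r, Set.mem_Ioi.mpr ?_⟩,
    ⟨4 * colourBound (k + 1) + 1, by positivity, fun _ => le_rfl⟩, ?_⟩
  · exact mul_pos (by positivity) r.2
  rintro ℓ - V _ G ⟨π, hπ⟩ r hr
  exact G.exists_isColouring r.2
    ⟨fun P hP => (hπ.1 P hP).trans (ENNReal.ofReal_le_ofReal hr), hπ.2⟩
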